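/- **The Schori solenoid.** Let $\overline X_0$ be the compact surface made of two cut $1$-handles $H$ and $F$ as follows: each is an annulus $[0,1]\times\mathbb R/\mathbb Z$ without an open disc, and the two are glued along the boundary circles of the removed discs. Gluing the two ends $\{1\}\times\mathbb R/\mathbb Z$ and $\{0\}\times\mathbb R/\mathbb Z$ of each handle gives the closed genus two surface $X_0$, with closed curves $C_0\subset H$ and $D_0\subset F$ (the cuts). Inductively, given $X_\ell$, made of $3^\ell$ copies of $\overline X_0$, with curves $C_\ell$ and $D_\ell$, each a lift of $C_0$, respectively $D_0$, cut $X_\ell$ along $C_\ell$ and $D_\ell$, take three copies numbered $0,1,2$ of the resulting surface, and reglue them: along $C_\ell$ copies $0$ and $1$ are joined crosswise (each side of the cut in one copy is glued to the opposite side in the other copy) and copy $2$ is closed up; along $D_\ell$ copies $1$ and $2$ are joined crosswise and copy $0$ is closed up. This gives a surface $X_{\ell+1}$ and a $3$-to-$1$ covering map $X_{\ell+1}\to X_\ell$. The next curve $C_{\ell+1}$ (respectively $D_{\ell+1}$) is any lift of $C_0$ (respectively $D_0$) which crosses the longer handle formed by joining two copies crosswise along $C_\ell$ (respectively $D_\ell$).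 A Schori solenoid is $\mathcal S=\varprojlim X_\ell\subset\prod_\ell X_\ell$, for any such choice of curves. **Holonomy.** Fix $x_0\in X_0$, let $G_0=\pi_1(X_0,x_0)$ and let $\mathfrak X_0\subset\mathcal S$ be the fibre over $x_0$. For $g=[\gamma]\in G_0$ and $y=(y_\ell)\in\mathfrak X_0$ put $\Phi_0(g)(y)=(\gamma_\ell(1))_\ell$, where $\gamma_\ell$ is the lift of $\gamma$ to $X_\ell$ with $\gamma_\ell(0)=y_\ell$; this is an action of $G_0$ on $\mathfrak X_0$ by homeomorphisms. For $y\in\mathfrak X_0$ and $n\ge 0$ let $U_n^y=\{z\in\mathfrak X_0 : z_n=y_n\}$, let $G_n^y\subset G_0$ be the image of $\pi_1(X_n,y_n)$, and let $\Phi_n$ be the restricted action of $G_n^y$ on $U_n^y$. **SQA.** A family of homeomorphisms between open subsets of a space is strongly quasi-analytic (SQA) if each of its elements that is the identity on some non-empty open subset of its domain is the identity on its whole domain. An action by homeomorphisms is SQA if the family of all restrictions of its elements to open sets is SQA. **Theorem.** Let $\mathcal S$ be a Schori solenoid and $x_0\in X_0$. For every basepoint $y\in\mathfrak X_0$ and every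 $n\ge 0$, the holonomy action $(U_n^y,G_n^y,\Phi_n)$ is not SQA. Moreover there are $g\in G_n^y$ and pairwise disjoint non-empty clopen sets $A,B,C\subset U_n^y$ such that $\Phi_n(g)$ is the identity on $A$, $\Phi_n(g)(B)=C$ and $\Phi_n(g)(C)=B$. Also, for every non-empty clopen set $V\subset\mathfrak X_0$, the induced holonomy pseudo$\star$group on $V$ (all restrictions of the maps $\Phi_0(g)$, $g\in G_0$, to open sets $O\subset V$ with $\Phi_0(g)(O)\subset V$) is not SQA. -/

import Mathlib

open Set Topology

/-! ### Strongly quasi-analytic actions -/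

/-- The collection of all restrictions to open sets of the homeomorphisms `Φ g`, `g ∈ G`. -/
def pseudoStarGroup {G T : Type*} [Group G] [TopologicalSpace T] (Φ : G →* (T ≃ₜ T)) :
    Set (OpenPartialHomeomorph T T) :=
  {h | ∃ g : G, EqOn h (Φ g) h.source}

/-- The members of a family of local homeomorphisms with domain and range in `V`. -/
def inducedOn {T : Type*} [TopologicalSpace T] (𝒢 : Set (OpenPartialHomeomorph T T))
    (V : Set T) : Set (OpenPartialHomeomorph T T) :=
  {h | h ∈ 𝒢 ∧ h.source ⊆ V ∧ h.target ⊆ V}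

/-- Strong quasi-analyticity (SQA): an element which is the identity on a non-empty open subset
of its domain is the identity on its whole domain. -/
def IsSQA {T : Type*} [TopologicalSpace T] (𝒢 : Set (OpenPartialHomeomorph T T)) : Prop :=
  ∀ h ∈ 𝒢, ∀ U : Set T, IsOpen U → U.Nonempty → U ⊆ h.source → EqOn h id U → EqOn h id h.source

/-! ### Towers of coverings, their inverse limits, and the holonomy action -/

/-- A presentation: a sequence of covering maps `p ℓ : M (ℓ + 1) → M ℓ`. -/
structure Presentation where
  M : ℕ → Type
  [top : ∀ ℓ, TopologicalSpace (M ℓ)]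
  p : ∀ ℓ, M (ℓ + 1) → M ℓ
  cov : ∀ ℓ, IsCoveringMap (p ℓ)

namespace Presentation

attribute [instance] Presentation.top

variable (P : Presentation)

/-- The inverse limit of the tower, with the topology induced from the product. -/
abbrev Solenoid : Type := {z : ∀ ℓ, P.M ℓ // ∀ ℓ, P.p ℓ (z (ℓ + 1)) = z ℓ}

/-- The fibre over `x₀` of the projection of the inverse limit to `M 0`. -/
abbrev Fiber (x₀ : P.M 0) : Type := {z : P.Solenoid // z.1 0 = x₀}

/-- The composite covering `q n = p 0 ∘ ⋯ ∘ p (n - 1) : M n → M 0`. -/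
def q : ∀ n, C(P.M n, P.M 0)
  | 0 => ContinuousMap.id _
  | n + 1 => (q n).comp ⟨P.p n, (P.cov n).continuous⟩

lemma q_apply (z : P.Solenoid) : ∀ n, P.q n (z.1 n) = z.1 0
  | 0 => rfl
  | n + 1 => (congrArg (P.q n) (z.2 n)).trans (q_apply z n)

variable {P}

/-- The successive lifts of a path `γ` in `M 0`, the one in `M ℓ` starting at `z ℓ`. -/
noncomputable def lift (z : P.Solenoid) (γ : C(unitInterval, P.M 0)) (h : γ 0 = z.1 0) :
    ∀ ℓ, {Γ : C(unitInterval, P.M ℓ) // Γ 0 = z.1 ℓ}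
  | 0 => ⟨γ, h⟩
  | ℓ + 1 => ⟨(P.cov ℓ).liftPath (lift z γ h ℓ).1 (z.1 (ℓ + 1))
      ((lift z γ h ℓ).2.trans (z.2 ℓ).symm), (P.cov ℓ).liftPath_zero _ _ _⟩

lemma p_lift (z : P.Solenoid) (γ : C(unitInterval, P.M 0)) (h : γ 0 = z.1 0) (ℓ : ℕ) (t : unitInterval) :
    P.p ℓ ((lift z γ h (ℓ + 1)).1 t) = (lift z γ h ℓ).1 t :=
  congrFun ((P.cov ℓ).liftPath_lifts (lift z γ h ℓ).1 (z.1 (ℓ + 1))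
    ((lift z γ h ℓ).2.trans (z.2 ℓ).symm)) t

lemma lift_unique (z : P.Solenoid) (γ : C(unitInterval, P.M 0)) (h : γ 0 = z.1 0) : ∀ (n : ℕ)
    (δ : C(unitInterval, P.M n)), (P.q n).comp δ = γ → δ 0 = z.1 n → (lift z γ h n).1 = δ
  | 0, _, hδ, _ => hδ.symm
  | n + 1, δ, hδ, h0 => by
      have ih := lift_unique z γ h n (ContinuousMap.comp ⟨P.p n, (P.cov n).continuous⟩ δ)
        (by rw [← hδ]; rfl) (by rw [← z.2 n, ← h0]; rfl)
      refine ((P.cov n).eq_liftPath_iff'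
        ((lift z γ h n).2.trans (z.2 n).symm) |>.mpr ⟨?_, h0⟩).symm
      rw [ih]; rfl

lemma q_lift (z : P.Solenoid) (γ : C(unitInterval, P.M 0)) (h : γ 0 = z.1 0) :
    ∀ n, (P.q n).comp (lift z γ h n).1 = γ
  | 0 => rfl
  | n + 1 => by
      have ih := q_lift z γ h n
      ext t
      exact (congrArg (P.q n) (p_lift z γ h n t)).trans (congrArg (fun f : C(unitInterval, P.M 0) => f t) ih)

lemma lift_homotopic (z : P.Solenoid) {γ γ' : C(unitInterval, P.M 0)} (h : γ 0 = z.1 0) (h' : γ' 0 = z.1 0)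
    (H : γ.HomotopicRel γ' {0, 1}) : ∀ ℓ, (lift z γ h ℓ).1.HomotopicRel (lift z γ' h' ℓ).1 {0, 1}
  | 0 => H
  | ℓ + 1 => (P.cov ℓ).homotopicRel_liftPath (lift_homotopic z h h' H ℓ) _
      ((lift z γ h ℓ).2.trans (z.2 ℓ).symm) ((lift z γ' h' ℓ).2.trans (z.2 ℓ).symm)

lemma coord_eq_of_le {z z' : P.Solenoid} {ℓ : ℕ} (h : z.1 ℓ = z'.1 ℓ) {j : ℕ} (hj : j ≤ ℓ) :
    z.1 j = z'.1 j := by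
  induction hj with
  | refl => exact h
  | step _ ih => exact ih (by rw [← z.2, ← z'.2, h])

variable {x₀ : P.M 0}

/-- The endpoint of the lift of the loop `γ` which starts at `z`. -/
noncomputable def transport (γ : Path x₀ x₀) (z : P.Fiber x₀) : P.Fiber x₀ :=
  ⟨⟨fun ℓ => (lift z.1 γ (γ.source.trans z.2.symm) ℓ).1 1, fun ℓ => p_lift _ _ _ ℓ 1⟩, γ.target⟩

lemma transport_homotopic {γ γ' : Path x₀ x₀} (H : γ.Homotopic γ') (z : P.Fiber x₀) :
    transport γ z = transport γ' z := by
  refine Subtype.ext (Subtype.ext (funext fun ℓ => ?_))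
  have K := (lift_homotopic z.1 (γ.source.trans z.2.symm) (γ'.source.trans z.2.symm) H ℓ).some
  exact (K.eq_fst 0 (.inr rfl)).symm.trans (K.eq_snd 0 (.inr rfl))

/-- The map `h_g` of the fibre given by the homotopy class `g` of a loop. -/
noncomputable def holonomyMap (g : FundamentalGroup (P.M 0) x₀) (z : P.Fiber x₀) : P.Fiber x₀ :=
  Quotient.lift (fun γ : Path x₀ x₀ => transport γ z) (fun _ _ H => transport_homotopic H z) g

lemma holonomyMap_one (z : P.Fiber x₀) : holonomyMap 1 z = z := by
  refine Subtype.ext (Subtype.ext (funext fun ℓ => ?_))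
  have := lift_unique z.1 (Path.refl x₀ : C(unitInterval, P.M 0)) z.2.symm ℓ (.const _ (z.1.1 ℓ))
    (by ext t; exact (P.q_apply z.1 ℓ).trans z.2) rfl
  exact congrArg (fun f : C(unitInterval, P.M ℓ) => f 1) this

lemma transport_trans (γ γ' : Path x₀ x₀) (z : P.Fiber x₀) :
    transport (γ.trans γ') z = transport γ' (transport γ z) := by
  refine Subtype.ext (Subtype.ext (funext fun ℓ => ?_))
  have h := γ.source.trans z.2.symm
  let w := transport γ z
  have h' := γ'.source.trans w.2.symm
  let a : Path (z.1.1 ℓ) (w.1.1 ℓ) := ⟨(lift z.1 γ h ℓ).1, (lift z.1 γ h ℓ).2, rfl⟩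
  let b : Path (w.1.1 ℓ) ((transport γ' w).1.1 ℓ) :=
    ⟨(lift w.1 γ' h' ℓ).1, (lift w.1 γ' h' ℓ).2, rfl⟩
  have := lift_unique z.1 (γ.trans γ' : C(unitInterval, P.M 0)) ((γ.trans γ').source.trans z.2.symm) ℓ
    (a.trans b : C(unitInterval, P.M ℓ)) (by
      ext t
      change P.q ℓ ((a.trans b) t) = (γ.trans γ') t
      rw [Path.trans_apply, Path.trans_apply]
      split_ifs
      · exact congrArg (fun f : C(unitInterval, P.M 0) => f _) (q_lift z.1 γ h ℓ)
      · exact congrArg (fun f : C(unitInterval, P.M 0) => f _) (q_lift w.1 γ' h' ℓ))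
    (a.trans b).source
  exact (congrArg (fun f : C(unitInterval, P.M ℓ) => f 1) this).trans (a.trans b).target

lemma holonomyMap_mul (g g' : FundamentalGroup (P.M 0) x₀) (z : P.Fiber x₀) :
    holonomyMap (g * g') z = holonomyMap g (holonomyMap g' z) := by
  induction g using Quotient.inductionOn with | _ γ
  induction g' using Quotient.inductionOn with | _ γ'
  exact transport_trans γ' γ z

/-- The cylinder `{z | z n = y n}` in the fibre, i.e. the transverse section `U n y`. -/
def cylinder (y : P.Fiber x₀) (n : ℕ) : Set (P.Fiber x₀) := {z | z.1.1 n = y.1.1 n}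

lemma isOpen_cylinder (y : P.Fiber x₀) : ∀ n, IsOpen (cylinder y n)
  | 0 => by
      convert isOpen_univ
      exact eq_univ_of_forall fun z => z.2.trans y.2.symm
  | n + 1 => by
      obtain ⟨e, he, hpe⟩ := (P.cov n).isLocalHomeomorph (y.1.1 (n + 1))
      have : cylinder y (n + 1) =
          cylinder y n ∩ (fun z : P.Fiber x₀ => z.1.1 (n + 1)) ⁻¹' e.source := by
        ext z
        refine ⟨fun hz => ⟨coord_eq_of_le hz n.le_succ, ?_⟩, fun hz => e.injOn hz.2 he ?_⟩
        · change z.1.1 (n + 1) ∈ e.source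
          rwa [show z.1.1 (n + 1) = _ from hz]
        · rw [← hpe, z.1.2, y.1.2]; exact hz.1
      rw [this]
      exact (isOpen_cylinder y n).inter (e.open_source.preimage
        ((continuous_apply _).comp (continuous_subtype_val.comp continuous_subtype_val)))

lemma lift_congr {z z' : P.Solenoid} (γ : C(unitInterval, P.M 0)) (h : γ 0 = z.1 0) (h' : γ 0 = z'.1 0)
    {ℓ : ℕ} (hz : z'.1 ℓ = z.1 ℓ) : (lift z γ h ℓ).1 = (lift z' γ h' ℓ).1 :=
  lift_unique z γ h ℓ _ (q_lift z' γ h' ℓ) ((lift z' γ h' ℓ).2.trans hz)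

lemma continuous_transport (γ : Path x₀ x₀) : Continuous (transport (P := P) γ) := by
  refine Continuous.subtype_mk (Continuous.subtype_mk (continuous_pi fun ℓ => ?_) _) _
  refine continuous_iff_continuousAt.mpr fun z => ?_
  refine (continuousAt_const (y := (transport γ z).1.1 ℓ)).congr (Filter.eventually_of_mem
    ((isOpen_cylinder z ℓ).mem_nhds rfl) fun z' hz' => ?_)
  exact congrArg (fun f : C(unitInterval, P.M ℓ) => f 1) (lift_congr γ _ _ hz')

lemma continuous_holonomyMap (g : FundamentalGroup (P.M 0) x₀) :
    Continuous (holonomyMap (P := P) g) := by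
  induction g using Quotient.inductionOn with | _ γ
  exact continuous_transport γ

/-- The global holonomy action `π₁(M 0, x₀) → Homeo(𝔛₀)` on the fibre over `x₀`. -/
noncomputable def holonomy (x₀ : P.M 0) :
    FundamentalGroup (P.M 0) x₀ →* (P.Fiber x₀ ≃ₜ P.Fiber x₀) where
  toFun g :=
    { toFun := holonomyMap g
      invFun := holonomyMap g⁻¹
      left_inv := fun z => by rw [← holonomyMap_mul, inv_mul_cancel, holonomyMap_one]
      right_inv := fun z => by rw [← holonomyMap_mul, mul_inv_cancel, holonomyMap_one]
      continuous_toFun := continuous_holonomyMap g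
      continuous_invFun := continuous_holonomyMap g⁻¹ }
  map_one' := Homeomorph.ext holonomyMap_one
  map_mul' g g' := Homeomorph.ext (holonomyMap_mul g g')

/-- The group `G n y`: the image of `π₁(M n, y n)` in `π₁(M 0, x₀)` under `q n`. -/
noncomputable def chainGroup (y : P.Fiber x₀) (n : ℕ) : Subgroup (FundamentalGroup (P.M 0) x₀) :=
  (FundamentalGroup.mapOfEq (P.q n) ((P.q_apply y.1 n).trans y.2)).range

lemma holonomyMap_mem_cylinder (y : P.Fiber x₀) (n : ℕ) {g : FundamentalGroup (P.M 0) x₀}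
    (hg : g ∈ chainGroup y n) {z : P.Fiber x₀} (hz : z ∈ cylinder y n) :
    holonomyMap g z ∈ cylinder y n := by
  obtain ⟨a, rfl⟩ := hg
  rw [FundamentalGroup.mapOfEq_apply]
  induction a using Quotient.inductionOn with | _ γ
  have e := (P.q_apply y.1 n).trans y.2
  have := lift_unique z.1 (((γ.map (P.q n).continuous).cast e.symm e.symm : Path x₀ x₀) :
    C(unitInterval, P.M 0)) (by rw [z.2]; exact Path.source _) n (γ : C(unitInterval, P.M n))
    (by ext t; rfl) (γ.source.trans hz.symm)
  exact (congrArg (fun f : C(unitInterval, P.M n) => f 1) this).trans γ.target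

/-- The holonomy action of `G n y` on the transverse section `U n y`. -/
noncomputable def sectionHolonomy (y : P.Fiber x₀) (n : ℕ) :
    chainGroup y n →* (cylinder y n ≃ₜ cylinder y n) where
  toFun g :=
    { toFun := fun z => ⟨holonomy x₀ g z, holonomyMap_mem_cylinder y n g.2 z.2⟩
      invFun := fun z => ⟨holonomy x₀ (g⁻¹ : chainGroup y n) z,
        holonomyMap_mem_cylinder y n (g⁻¹).2 z.2⟩
      left_inv := fun z => Subtype.ext (by simp)
      right_inv := fun z => Subtype.ext (by simp)
      continuous_toFun := by fun_prop
      continuous_invFun := by fun_prop }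
  map_one' := Homeomorph.ext fun z => Subtype.ext (holonomyMap_one z.1)
  map_mul' g g' := Homeomorph.ext fun z => Subtype.ext (holonomyMap_mul g.1 g'.1 z.1)

end Presentation

/-! ### Surfaces glued from cut handles -/

/-- The two handles of the genus two surface. -/
inductive Handle
  | H
  | F

/-- A handle (a torus without an open disc), cut along a closed curve: the annulus
`[0,1] × ℝ/ℤ` without the open disc `|t - 1/2| < 1/4`, `‖θ‖ < 1/4`. -/
abbrev CutHandle : Type :=
  {a : unitInterval × UnitAddCircle // 1 / 4 ≤ max |(a.1 : ℝ) - 1 / 2| ‖a.2‖}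

namespace CutHandle

/-- The boundary circle of the removed disc. -/
def OnRim (a : CutHandle) : Prop := max |(a.1.1 : ℝ) - 1 / 2| ‖a.1.2‖ = 1 / 4

/-- One side `t = 1` of the cut. -/
def outgoing (θ : UnitAddCircle) : CutHandle :=
  ⟨(1, θ), le_max_of_le_left (by norm_num [abs_of_pos])⟩

/-- The other side `t = 0` of the cut. -/
def incoming (θ : UnitAddCircle) : CutHandle :=
  ⟨(0, θ), le_max_of_le_left (by norm_num [abs_of_neg])⟩

end CutHandle

/-- Gluing rules for `W`-indexed copies of the two cut handles.  In each copy the handles `H`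
and `F` are glued along their rims, which gives a copy of the genus two surface cut along two
curves; the side `t = 1` of the cut of the handle `k` in copy `w` is glued to the
side `t = 0` of the cut of the handle `k` in copy `σ k w`. -/
inductive Glue {W : Type} (σ : Handle → Equiv.Perm W) :
    (Σ _ : Handle × W, CutHandle) → (Σ _ : Handle × W, CutHandle) → Prop
  | rim (w : W) (a : CutHandle) (ha : a.OnRim) : Glue σ ⟨(.H, w), a⟩ ⟨(.F, w), a⟩
  | seam (k : Handle) (w : W) (θ : UnitAddCircle) :
      Glue σ ⟨(k, w), CutHandle.outgoing θ⟩ ⟨(k, σ k w), CutHandle.incoming θ⟩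

/-- The closed surface glued from `W`-indexed copies of the cut genus two surface. -/
def Surface {W : Type} (σ : Handle → Equiv.Perm W) : Type := Quot (Glue σ)

namespace Surface

instance {W : Type} (σ : Handle → Equiv.Perm W) : TopologicalSpace (Surface σ) :=
  inferInstanceAs (TopologicalSpace (Quot _))

/-- The map of surfaces induced by an equivariant map of index sets. -/
def map {W V : Type} {σ : Handle → Equiv.Perm W} {τ : Handle → Equiv.Perm V} (f : W → V)
    (hf : ∀ k w, f (σ k w) = τ k (f w)) : Surface σ → Surface τ :=
  Quot.map (fun x => ⟨(x.1.1, f x.1.2), x.2⟩) (by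
    rintro _ _ (⟨w, a, ha⟩ | ⟨k, w, θ⟩)
    · exact .rim (f w) a ha
    · simpa [hf] using Glue.seam (σ := τ) k (f w) θ)

section Covering

/-- A region of the cut handles over which the glued surfaces have a locally constant label:
over `lo` the label of a point is the index of its copy, and over `hi` it is the index of the copy
on the other side of the cut. -/
structure Region where
  lo : Handle → Set CutHandle
  hi : Handle → Set CutHandle
  lo_open : ∀ k, IsOpen (lo k)
  hi_open : ∀ k, IsOpen (hi k)
  disj : ∀ k a, a ∈ lo k → a ∉ hi k
  rim_lo : ∀ a : CutHandle, a.OnRim → (a ∈ lo .H ↔ a ∈ lo .F)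
  rim_hi : ∀ a : CutHandle, a.OnRim → ∀ k, a ∉ hi k
  seam_hi : ∀ k θ, CutHandle.outgoing θ ∉ lo k
  seam_lo : ∀ k θ, CutHandle.incoming θ ∉ hi k
  seam_iff : ∀ k θ, CutHandle.outgoing θ ∈ hi k ↔ CutHandle.incoming θ ∈ lo k

variable {W V : Type} {σ : Handle → Equiv.Perm W} {τ : Handle → Equiv.Perm V}

/-- The part of the region in the glued surface where the label is `w`. -/
def Region.sheet (R : Region) (σ : Handle → Equiv.Perm W) (w : W) : Set (Surface σ) :=
  {z | Quot.lift (fun x : Σ _ : Handle × W, CutHandle =>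
      (x.2 ∈ R.lo x.1.1 ∧ x.1.2 = w) ∨ (x.2 ∈ R.hi x.1.1 ∧ σ x.1.1 x.1.2 = w)) (by
    rintro _ _ (⟨w, a, ha⟩ | ⟨k, w, θ⟩)
    · simp [R.rim_lo a ha, R.rim_hi a ha]
    · simp [R.seam_hi, R.seam_lo, R.seam_iff]) z}

open Classical in
/-- The sheet with label `w`, as a (partial) section. -/
noncomputable def Region.sec [Nonempty (Surface σ)] (R : Region) (τ : Handle → Equiv.Perm V)
    (w : W) : Surface τ → Surface σ :=
  Quot.lift (fun x : Σ _ : Handle × V, CutHandle =>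
      if x.2 ∈ R.lo x.1.1 then Quot.mk _ ⟨(x.1.1, w), x.2⟩
      else if x.2 ∈ R.hi x.1.1 then Quot.mk _ ⟨(x.1.1, (σ x.1.1).symm w), x.2⟩
      else Classical.arbitrary (Surface σ)) (by
    rintro _ _ (⟨v, a, ha⟩ | ⟨k, v, θ⟩)
    · by_cases h : a ∈ R.lo .H
      · exact (if_pos h).trans ((Quot.sound (.rim w a ha)).trans
          (if_pos ((R.rim_lo a ha).mp h)).symm)
      · exact ((if_neg h).trans (if_neg (R.rim_hi a ha _))).trans
          ((if_neg (h ∘ (R.rim_lo a ha).mpr)).trans (if_neg (R.rim_hi a ha _))).symm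
    · refine (if_neg (R.seam_hi k θ)).trans ?_
      by_cases h : CutHandle.outgoing θ ∈ R.hi k
      · refine (if_pos h).trans (Eq.trans ?_ (if_pos ((R.seam_iff k θ).mp h)).symm)
        exact Quot.sound (by simpa using Glue.seam (σ := σ) k ((σ k).symm w) θ)
      · exact (if_neg h).trans ((if_neg (h ∘ (R.seam_iff k θ).mpr)).trans
          (if_neg (R.seam_lo k θ))).symm)

lemma isOpen_iff {s : Set (Surface σ)} :
    IsOpen s ↔ ∀ k w, IsOpen {a : CutHandle | (Quot.mk _ ⟨(k, w), a⟩ : Surface σ) ∈ s} := by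
  refine (isOpen_coinduced (f := Quot.mk (Glue σ)) (s := s)).trans (isOpen_sigma_iff.trans ?_)
  exact ⟨fun h k w => h (k, w), fun h x => h x.1 x.2⟩

lemma Region.isOpen_sheet (R : Region) (w : W) : IsOpen (R.sheet σ w) := by
  refine isOpen_iff.mpr fun k u => ?_
  exact ((R.lo_open k).inter (isOpen_const (p := u = w))).union
    ((R.hi_open k).inter (isOpen_const (p := σ k u = w)))

lemma Region.isEvenlyCovered (R : Region) (f : W → V) (hf : ∀ k w, f (σ k w) = τ k (f w))
    (hs : Function.Surjective f) (v : V) (x : Surface τ) (hx : x ∈ R.sheet τ v) :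
    IsEvenlyCovered (map f hf) x (map f hf ⁻¹' {x}) := by
  obtain ⟨w₀, hw₀⟩ := hs v
  have hf' : ∀ k w, f ((σ k).symm w) = (τ k).symm (f w) := fun k w => by
    rw [Equiv.eq_symm_apply, ← hf, Equiv.apply_symm_apply]
  have hne : Nonempty (Surface σ) := by
    obtain ⟨⟨⟨k, _⟩, a⟩⟩ := x
    exact ⟨Quot.mk _ ⟨(k, w₀), a⟩⟩
  have left : ∀ w, ∀ z ∈ R.sheet σ w, R.sec (σ := σ) τ w (map f hf z) = z := by
    rintro w ⟨⟨⟨k, u⟩, a⟩⟩ (⟨h, rfl⟩ | ⟨h, rfl⟩)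
    · exact if_pos h
    · refine (if_neg fun h' => R.disj k a h' h).trans ((if_pos h).trans ?_)
      simp only [Equiv.symm_apply_apply]; rfl
  let ι := {w : W // f w = v}
  have : Nonempty ι := ⟨⟨w₀, hw₀⟩⟩
  let _ : TopologicalSpace ι := ⊥
  have : DiscreteTopology ι := ⟨rfl⟩
  have : Nonempty (Surface τ → Surface σ) := ⟨fun _ => hne.some⟩
  refine (IsEvenlyCovered.of_trivialization (t := IsOpen.trivializationDiscrete (ι := ι)
    (fun w => R.sheet σ w.1) (R.sheet τ v) (R.isOpen_sheet v) (f := map f hf)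
    ?_ ?_ ?_ ?_ ?_) hx).to_isEvenlyCovered_preimage
  · rintro ⟨w, hw⟩ O hO
    rw [isOpen_iff, isOpen_iff]
    constructor
    · intro h k u
      exact (h k (f u)).inter (isOpen_iff.mp (R.isOpen_sheet w) k u)
    · intro h k u
      have key : {a : CutHandle | (Quot.mk _ ⟨(k, u), a⟩ : Surface τ) ∈ O} =
          (({a | (Quot.mk _ ⟨(k, w), a⟩ : Surface σ) ∈ map f hf ⁻¹' O ∩ R.sheet σ w} ∩ R.lo k) ∩
            {_a | u = v}) ∪
          (({a | (Quot.mk _ ⟨(k, (σ k).symm w), a⟩ : Surface σ) ∈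
            map f hf ⁻¹' O ∩ R.sheet σ w} ∩ R.hi k) ∩ {_a | τ k u = v}) := by
        ext a
        constructor
        · intro ha
          rcases hO ha with ⟨h1, h2⟩ | ⟨h1, h2⟩
          · refine .inl ⟨⟨⟨?_, .inl ⟨h1, rfl⟩⟩, h1⟩, h2⟩
            change (Quot.mk _ ⟨(k, f w), a⟩ : Surface τ) ∈ O
            rw [hw, ← show u = v from h2]; exact ha
          · refine .inr ⟨⟨⟨?_, .inr ⟨h1, by simp⟩⟩, h1⟩, h2⟩
            change (Quot.mk _ ⟨(k, f ((σ k).symm w)), a⟩ : Surface τ) ∈ O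
            rw [hf', hw, ← show τ k u = v from h2, Equiv.symm_apply_apply]; exact ha
        · rintro (⟨⟨⟨h1, _⟩, _⟩, h2⟩ | ⟨⟨⟨h1, _⟩, _⟩, h2⟩)
          · change (Quot.mk _ ⟨(k, f w), a⟩ : Surface τ) ∈ O at h1
            rw [hw, ← show u = v from h2] at h1; exact h1
          · change (Quot.mk _ ⟨(k, f ((σ k).symm w)), a⟩ : Surface τ) ∈ O at h1
            rw [hf', hw, ← show τ k u = v from h2, Equiv.symm_apply_apply] at h1; exact h1
      rw [key]
      exact (((h k w).inter (R.lo_open k)).inter isOpen_const).union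
        (((h k _).inter (R.hi_open k)).inter isOpen_const)
  · intro w z hz z' hz' e
    rw [← left w z hz, e, left w z' hz']
  · rintro ⟨w, hw⟩ ⟨⟨⟨k, u⟩, a⟩⟩ (⟨h1, h2⟩ | ⟨h1, h2⟩)
    · refine ⟨Quot.mk _ ⟨(k, w), a⟩, .inl ⟨h1, rfl⟩, ?_⟩
      change (Quot.mk _ ⟨(k, f w), a⟩ : Surface τ) = _
      rw [hw, ← show u = v from h2]
    · refine ⟨Quot.mk _ ⟨(k, (σ k).symm w), a⟩, .inr ⟨h1, by simp⟩, ?_⟩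
      change (Quot.mk _ ⟨(k, f ((σ k).symm w)), a⟩ : Surface τ) = _
      rw [hf', hw, ← show τ k u = v from h2, Equiv.symm_apply_apply]
  · rintro ⟨w, hw⟩ ⟨w', hw'⟩ hne
    refine Set.disjoint_left.mpr ?_
    rintro ⟨⟨⟨k, u⟩, a⟩⟩ (⟨h1, h2⟩ | ⟨h1, h2⟩) (⟨h3, h4⟩ | ⟨h3, h4⟩)
    · exact hne (Subtype.ext (h2.symm.trans h4))
    · exact R.disj k a h1 h3
    · exact R.disj k a h3 h1
    · exact hne (Subtype.ext (h2.symm.trans h4))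
  · rintro ⟨⟨⟨k, u⟩, a⟩⟩ (⟨h1, h2⟩ | ⟨h1, h2⟩)
    · exact mem_iUnion.mpr ⟨⟨u, h2⟩, .inl ⟨h1, rfl⟩⟩
    · exact mem_iUnion.mpr ⟨⟨σ k u, (hf k u).trans h2⟩, .inr ⟨h1, rfl⟩⟩

lemma continuous_coord : Continuous fun a : CutHandle => (a.1.1 : ℝ) :=
  continuous_subtype_val.comp (continuous_fst.comp continuous_subtype_val)

/-- The complement of the cuts. -/
def interiorRegion : Region where
  lo _ := {a | 0 < (a.1.1 : ℝ) ∧ (a.1.1 : ℝ) < 1}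
  hi _ := ∅
  lo_open _ := (isOpen_lt continuous_const continuous_coord).inter
    (isOpen_lt continuous_coord continuous_const)
  hi_open _ := isOpen_empty
  disj _ _ _ := id
  rim_lo _ _ := Iff.rfl
  rim_hi _ _ _ := id
  seam_hi k θ := by simp [CutHandle.outgoing]
  seam_lo _ _ := id
  seam_iff k θ := by simp [CutHandle.incoming]

/-- A collar of the cut of the handle `k₀`. -/
def collarRegion (k₀ : Handle) : Region where
  lo k := {a | k = k₀ ∧ (a.1.1 : ℝ) < 1 / 4}
  hi k := {a | k = k₀ ∧ 3 / 4 < (a.1.1 : ℝ)}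
  lo_open _ := isOpen_const.and (isOpen_lt continuous_coord continuous_const)
  hi_open _ := isOpen_const.and (isOpen_lt continuous_const continuous_coord)
  disj k a h h' := by have := h.2; have := h'.2; linarith
  rim_lo a ha := by
    have h := abs_le.mp ((le_max_left _ _).trans ha.le)
    constructor <;> rintro ⟨-, h'⟩ <;> linarith [h.1]
  rim_hi a ha k := by
    have h := abs_le.mp ((le_max_left _ _).trans ha.le)
    rintro ⟨-, h'⟩; linarith [h.2]
  seam_hi k θ := by rintro ⟨-, h⟩; norm_num [CutHandle.outgoing] at h
  seam_lo k θ := by rintro ⟨-, h⟩; norm_num [CutHandle.incoming] at h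
  seam_iff k θ := by norm_num [CutHandle.incoming, CutHandle.outgoing]

/-- The map of surfaces induced by a surjective equivariant map is a covering map. -/
theorem isCoveringMap_map (f : W → V) (hf : ∀ k w, f (σ k w) = τ k (f w))
    (hs : Function.Surjective f) : IsCoveringMap (map f hf) := by
  rintro ⟨⟨⟨k, u⟩, a⟩⟩
  rcases lt_or_ge (a.1.1 : ℝ) (1 / 4) with h | h
  · exact (collarRegion k).isEvenlyCovered f hf hs u _ (.inl ⟨⟨rfl, h⟩, rfl⟩)
  rcases lt_or_ge (3 / 4) (a.1.1 : ℝ) with h' | h'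
  · exact (collarRegion k).isEvenlyCovered f hf hs (τ k u) _ (.inr ⟨⟨rfl, h'⟩, rfl⟩)
  · exact interiorRegion.isEvenlyCovered f hf hs u _ (.inl ⟨⟨by linarith, by linarith⟩, rfl⟩)

end Covering

end Surface

/-! ### The Schori solenoid -/

namespace Schori

/-- The indices of the `3 ^ ℓ` copies of the cut genus two surface which make up `X ℓ`; the
three copies of `X ℓ`, cut, that make up `X (ℓ + 1)` are numbered `0, 1, 2`. -/
def Copies : ℕ → Type
  | 0 => Unit
  | ℓ + 1 => Copies ℓ × Fin 3

/-- The identification of the three copies along the curve on the handle `k`: along `C ℓ` (on the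
handle `H`) the copies `0` and `1` are joined crosswise and the copy `2` is closed up; along
`D ℓ` (on the handle `F`) the copies `1` and `2` are joined crosswise and the copy `0` is
closed up. -/
def crossing : Handle → Equiv.Perm (Fin 3)
  | .H => Equiv.swap 0 1
  | .F => Equiv.swap 1 2

open Classical in
/-- Cut along the curve which leaves the copy `c`, take three copies, and reglue by `s`. -/
noncomputable def reglue {W : Type} (σ : Equiv.Perm W) (c : W) (s : Equiv.Perm (Fin 3)) :
    Equiv.Perm (W × Fin 3) where
  toFun x := (σ x.1, if x.1 = c then s x.2 else x.2)
  invFun x := (σ.symm x.1, if σ.symm x.1 = c then s.symm x.2 else x.2)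
  left_inv x := by ext <;> simp; split_ifs <;> simp
  right_inv x := by ext <;> simp; split_ifs <;> simp

variable (cut : ∀ ℓ, Handle → Copies ℓ)

/-- How the copies are glued in `X ℓ`. The curves `C ℓ`, `D ℓ` along which `X ℓ` is cut are
the sides `t = 1` of the cuts of the handles `H`, `F` in the copies `cut ℓ .H`, `cut ℓ .F`. -/
noncomputable def gluing : ∀ ℓ, Handle → Equiv.Perm (Copies ℓ)
  | 0 => fun _ => 1
  | ℓ + 1 => fun k => reglue (gluing ℓ k) (cut ℓ k) (crossing k)

/-- The surface `X ℓ`; `X 0` is a closed surface of genus two. -/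
def X (ℓ : ℕ) : Type := Surface (gluing cut ℓ)

noncomputable instance (ℓ : ℕ) : TopologicalSpace (X cut ℓ) :=
  inferInstanceAs (TopologicalSpace (Surface _))

/-- The three-to-one covering `X (ℓ + 1) → X ℓ`. -/
noncomputable def proj (ℓ : ℕ) : X cut (ℓ + 1) → X cut ℓ :=
  Surface.map (Prod.fst : Copies ℓ × Fin 3 → Copies ℓ) (fun _ _ => rfl)

/-- The next curve `C (ℓ + 1)` (resp. `D (ℓ + 1)`) is one of the lifts of `C 0` (resp. `D 0`)
that cross the handle of double length obtained by joining two of the three copies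
crosswise along `C ℓ` (resp. `D ℓ`). -/
def IsCutSequence : Prop :=
  ∀ ℓ k, (gluing cut (ℓ + 1) k).SameCycle ((cut ℓ k, 1) : Copies ℓ × Fin 3) (cut (ℓ + 1) k)

/-- The presentation of the Schori solenoid. -/
noncomputable def presentation : Presentation where
  M := X cut
  p := proj cut
  cov _ := Surface.isCoveringMap_map _ _ Prod.fst_surjective

end Schori

/-! The geometry reduces to permutations. Over a suitably represented point of X_0, the points of
X_ℓ are indexed by the copies, and a loop that crosses the cuts according to a word in `FreeGroup
Handle` permutes these indices by `monodromy`.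

Let c be the copy that the curve C_n leaves, and N the length of its cycle under the gluing of H in
X_n. Going N times across H returns to c after meeting C_n exactly once, so over c, in X_{n+1}, it
swaps the copies 0 and 1 and fixes the copy 2 (`reglue_pow_minimalPeriod`). Every later curve C_m
lies over the long handle, the cycle of (c, 1), and so never over the cycle of (c, 2). Hence over
(c, 2) the same loop closes up at all levels (`IsCutSequence.gluing_pow_eq_self`): it fixes one
cylinder pointwise and interchanges two others, which contradicts SQA.

To place this inside a given cylinder, conjugate by a word leading from the label of y_n to c. Such
a word exists by transitivity (`exists_monodromy_eq`), which holds because a cut does not disconnect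
a copy of X_ℓ: the remaining steps of the cycle go around it. Words become loops through `carries`,
and loops become holonomy maps through `exists_holonomyMap`. All this is combined in
`IsCutSequence.exists_holonomy_swap`. -/

theorem Equiv.Perm.rel_apply_of_forall_ne {W : Type*} [Finite W] (σ : Equiv.Perm W) (c : W)
    {r : W → W → Prop} (hr : Equivalence r) (h : ∀ x, x ≠ c → r x (σ x)) : r c (σ c) := by
  by_contra hc
  -- The class of `σ c` would miss `c`, hence be stable under `σ`. By finiteness `σ` is onto on it,
  -- so the class contains the preimage of `σ c`, which is `c`.
  let S : Set W := {x | r (σ c) x}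
  have hS : MapsTo σ S S := fun x hx => hr.trans hx
    (h x fun e => hc (hr.symm (Eq.subst (motive := r (σ c)) e hx)))
  obtain ⟨y, hy, e⟩ := (S.toFinite.injOn_iff_bijOn_of_mapsTo hS).1 σ.injective.injOn
    |>.surjOn (hr.refl (σ c))
  rw [σ.injective e] at hy
  exact hc (hr.symm hy)

namespace Schori

instance finite_copies : ∀ ℓ, Finite (Copies ℓ)
  | 0 => inferInstanceAs (Finite Unit)
  | ℓ + 1 => by
    have := finite_copies ℓ
    exact inferInstanceAs (Finite (Copies ℓ × Fin 3))

/-! ### The reglued permutation -/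

section Reglue

variable {W : Type} (σ : Equiv.Perm W) (c : W) (s : Equiv.Perm (Fin 3))

theorem reglue_apply_self (i : Fin 3) : reglue σ c s (c, i) = (σ c, s i) := by
  simp [reglue]

theorem reglue_apply_of_ne {w : W} (hw : w ≠ c) (i : Fin 3) :
    reglue σ c s (w, i) = (σ w, i) := by
  simp [reglue, hw]

theorem reglue_pow_fst (n : ℕ) (x : W × Fin 3) :
    ((reglue σ c s ^ n) x).1 = (σ ^ n) x.1 := by
  induction n with
  | zero => rfl
  | succ n ih => rw [pow_succ', pow_succ', Equiv.Perm.mul_apply, Equiv.Perm.mul_apply, ← ih]; rfl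

/-- After the first return to the place of the cut, the three copies are permuted by `s`. -/
theorem reglue_pow_minimalPeriod [Finite W] (i : Fin 3) :
    (reglue σ c s ^ Function.minimalPeriod σ c) (c, i) = (c, s i) := by
  have hpos : 0 < Function.minimalPeriod σ c :=
    Function.minimalPeriod_pos_of_mem_periodicPts (σ.injective.mem_periodicPts c)
  -- Only the first step starts over `c` and applies `s`; the others, before the return to `c`,
  -- leave the number alone.
  have key : ∀ j, j < Function.minimalPeriod σ c →
      (reglue σ c s ^ (j + 1)) (c, i) = ((σ ^ (j + 1)) c, s i) := by
    intro j hj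
    induction j with
    | zero => simpa using reglue_apply_self σ c s i
    | succ j ih =>
      rw [pow_succ', Equiv.Perm.mul_apply, ih (by omega), reglue_apply_of_ne, ← Equiv.Perm.mul_apply,
        ← pow_succ']
      rw [← Equiv.Perm.iterate_eq_pow]
      exact fun h => Function.not_isPeriodicPt_of_pos_of_lt_minimalPeriod j.succ_ne_zero hj h
  obtain ⟨j, hj⟩ := Nat.exists_eq_succ_of_ne_zero hpos.ne'
  have := key j (by omega)
  rw [← Nat.succ_eq_add_one, ← hj] at this
  rw [this, ← Equiv.Perm.iterate_eq_pow, Function.iterate_minimalPeriod]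

theorem reglue_pow_of_forall_ne {n : ℕ} {w : W} (h : ∀ j, (σ ^ j) w ≠ c) (i : Fin 3) :
    (reglue σ c s ^ n) (w, i) = ((σ ^ n) w, i) := by
  induction n with
  | zero => rfl
  | succ n ih =>
    rw [pow_succ', Equiv.Perm.mul_apply, ih, reglue_apply_of_ne _ _ _ (h n), pow_succ',
      Equiv.Perm.mul_apply]

theorem sameCycle_fst {x y : W × Fin 3} (h : (reglue σ c s).SameCycle x y) :
    σ.SameCycle x.1 y.1 := by
  obtain ⟨n, rfl⟩ := h
  induction n using Int.induction_on with
  | zero => exact .refl _ _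
  | succ n ih =>
    rw [add_comm, zpow_add, zpow_one, Equiv.Perm.mul_apply]
    exact ih.trans (Equiv.Perm.SameCycle.refl _ _).apply_right
  | pred n ih =>
    rw [sub_eq_add_neg, add_comm, zpow_add, zpow_neg_one, Equiv.Perm.mul_apply]
    exact ih.trans (Equiv.Perm.sameCycle_symm_apply_right.2 (.refl _ _))

/-- Numbers change only at the cut, and there by `s`; so being in the copy with a number fixed by
`s` is an invariant of cycles. This separates the closed-up copy from the long handle. -/
theorem sameCycle_snd_iff {i : Fin 3} (hi : s i = i) {x y : W × Fin 3}
    (h : (reglue σ c s).SameCycle x y) : x.2 = i ↔ y.2 = i := by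
  have step : ∀ x, ((reglue σ c s) x).2 = i ↔ x.2 = i := by
    rintro ⟨w, j⟩
    by_cases hw : w = c
    · subst hw
      rw [reglue_apply_self]
      exact ⟨fun h => s.injective (h.trans hi.symm), fun h => (congrArg s h).trans hi⟩
    · rw [reglue_apply_of_ne _ _ _ hw]
  obtain ⟨n, rfl⟩ := h
  induction n using Int.induction_on with
  | zero => simp
  | succ n ih =>
    rw [add_comm, zpow_add, zpow_one, Equiv.Perm.mul_apply, step]
    exact ih
  | pred n ih =>
    rw [sub_eq_add_neg, add_comm, zpow_add, zpow_neg_one, Equiv.Perm.mul_apply]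
    refine Iff.trans ?_ (step _)
    exact ih.trans (by rw [← Equiv.Perm.mul_apply, mul_inv_cancel]; rfl)

end Reglue

/-! ### Monodromy permutations of the copies -/

section Monodromy

variable (cut : ∀ ℓ, Handle → Copies ℓ)

/-- The permutation of the copies in `X ℓ` defined by a word in the loops that cross the cuts. -/
noncomputable def monodromy (ℓ : ℕ) : FreeGroup Handle →* Equiv.Perm (Copies ℓ) :=
  FreeGroup.lift (gluing cut ℓ)

theorem monodromy_of (ℓ : ℕ) (k : Handle) :
    monodromy cut ℓ (FreeGroup.of k) = gluing cut ℓ k :=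
  FreeGroup.lift_apply_of

theorem monodromy_fst (ℓ : ℕ) (u : FreeGroup Handle) :
    ∀ x : Copies ℓ × Fin 3, (monodromy cut (ℓ + 1) u x : Copies ℓ × Fin 3).1 =
      monodromy cut ℓ u x.1 := by
  have hof : ∀ (k : Handle) (x : Copies ℓ × Fin 3),
      (monodromy cut (ℓ + 1) (FreeGroup.of k) x : Copies ℓ × Fin 3).1 =
        monodromy cut ℓ (FreeGroup.of k) x.1 := fun k x => by
    rw [monodromy_of, monodromy_of]; rfl
  induction u using FreeGroup.induction_on with
  | C1 => intro x; rw [map_one, map_one]; rfl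
  | of k => exact hof k
  | inv_of k _ =>
    intro x
    rw [map_inv, map_inv, Equiv.Perm.eq_inv_iff_eq]
    exact (hof k _).symm.trans (congrArg Prod.fst (Equiv.apply_symm_apply _ _))
  | mul u v hu hv =>
    intro x
    rw [map_mul, map_mul, Equiv.Perm.mul_apply, ← hv x]
    exact hu _

/-- The monodromy permutations act transitively: the surfaces `X ℓ` are connected. -/
theorem exists_monodromy_eq : ∀ (ℓ : ℕ) (v w : Copies ℓ), ∃ u, monodromy cut ℓ u v = w
  | 0, _, _ => ⟨1, rfl⟩
  | ℓ + 1, v, w => by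
    let r : Copies ℓ × Fin 3 → Copies ℓ × Fin 3 → Prop :=
      fun x y => ∃ u, monodromy cut (ℓ + 1) u x = y
    have hr : Equivalence r :=
      { refl := fun x => ⟨1, rfl⟩
        symm := by
          rintro x _ ⟨u, rfl⟩
          exact ⟨u⁻¹, by rw [map_inv]; exact Equiv.symm_apply_apply _ _⟩
        trans := by
          rintro x _ _ ⟨u, rfl⟩ ⟨v, rfl⟩
          exact ⟨v * u, by rw [map_mul]; rfl⟩ }
    have hstep : ∀ k x, r x (reglue (gluing cut ℓ k) (cut ℓ k) (crossing k) x) :=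
      fun k x => ⟨FreeGroup.of k, by rw [monodromy_of]; rfl⟩
    -- Each of the three copies of X_ℓ stays connected after cutting: the step lost at the cut is
    -- replaced by the rest of its cycle.
    have hsheet : ∀ k w i, r (w, i) (gluing cut ℓ k w, i) := by
      intro k w i
      have hne : ∀ w, w ≠ cut ℓ k → r (w, i) (gluing cut ℓ k w, i) := fun w hw => by
        have := hstep k (w, i)
        rwa [reglue_apply_of_ne _ _ _ hw] at this
      by_cases hw : w = cut ℓ k
      · subst hw
        exact Equiv.Perm.rel_apply_of_forall_ne (gluing cut ℓ k) (cut ℓ k)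
          (hr.comap fun w => (w, i)) hne
      · exact hne w hw
    have hcopy : ∀ i u w, r (w, i) (monodromy cut ℓ u w, i) := by
      intro i u
      induction u using FreeGroup.induction_on with
      | C1 => exact fun w => hr.refl _
      | of k => intro w; rw [monodromy_of]; exact hsheet k w i
      | inv_of k _ =>
        intro w
        rw [map_inv, monodromy_of]
        have := hsheet k ((gluing cut ℓ k)⁻¹ w) i
        rw [← Equiv.Perm.mul_apply, mul_inv_cancel, Equiv.Perm.one_apply] at this
        exact hr.symm this
      | mul u v hu hv => intro w; rw [map_mul]; exact hr.trans (hv w) (hu _)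
    have hcopy' : ∀ i w w', r (w, i) (w', i) := fun i w w' => by
      obtain ⟨u, rfl⟩ := exists_monodromy_eq ℓ w w'
      exact hcopy i u w
    have hcross : ∀ k i w w', r (w, i) (w', crossing k i) := fun k i w w' => by
      have := hstep k (cut ℓ k, i)
      rw [reglue_apply_self] at this
      exact hr.trans (hcopy' i w _) (hr.trans this (hcopy' _ _ w'))
    -- Copy 1 is the hub: it is joined to copy 0 along the curve on `H` and to copy 2 along the
    -- curve on `F`.
    have h1 : ∀ i w w', r (w, i) (w', 1) := by
      intro i w w'
      fin_cases i
      · exact hcross .H 0 w w'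
      · exact hcopy' 1 w w'
      · exact hcross .F 2 w w'
    exact hr.trans (h1 v.2 v.1 w.1) (hr.symm (h1 w.2 w.1 w.1))

/-- The first `m` digits of the number of a copy. -/
def prefixOf (m : ℕ) : ∀ d, Copies (m + d) → Copies m
  | 0, w => w
  | d + 1, w => prefixOf m d (w : Copies (m + d) × Fin 3).1

theorem prefixOf_pow (m d : ℕ) (k : Handle) (n : ℕ) (w : Copies (m + d)) :
    prefixOf m d ((gluing cut (m + d) k ^ n) w) = (gluing cut m k ^ n) (prefixOf m d w) := by
  induction d with
  | zero => rfl
  | succ d ih => exact (congrArg (prefixOf m d) (reglue_pow_fst _ _ _ n w)).trans (ih w.1)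

theorem prefixOf_monodromy (m d : ℕ) (u : FreeGroup Handle) (w : Copies (m + d)) :
    prefixOf m d (monodromy cut (m + d) u w) = monodromy cut m u (prefixOf m d w) := by
  induction d with
  | zero => rfl
  | succ d ih => exact (congrArg (prefixOf m d) (monodromy_fst cut _ u w)).trans (ih w.1)

theorem sameCycle_prefixOf (m d : ℕ) (k : Handle) {v w : Copies (m + d)}
    (h : (gluing cut (m + d) k).SameCycle v w) :
    (gluing cut m k).SameCycle (prefixOf m d v) (prefixOf m d w) := by
  induction d with
  | zero => exact h
  | succ d ih => exact ih (sameCycle_fst _ _ _ h)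

variable {cut}

/-- Each new curve projects into the cycle of the previous one, and projections preserve cycles, so
all later curves stay over the long handle made at level `ℓ`. -/
theorem IsCutSequence.sameCycle_prefixOf_cut (hcut : IsCutSequence cut) (ℓ d : ℕ) (k : Handle) :
    (gluing cut (ℓ + 1) k).SameCycle ((cut ℓ k, 1) : Copies ℓ × Fin 3)
      (prefixOf (ℓ + 1) d (cut (ℓ + 1 + d) k)) := by
  induction d with
  | zero => exact hcut ℓ k
  | succ d ih =>
    exact ih.trans (sameCycle_prefixOf cut _ d k (sameCycle_fst _ _ _ (hcut (ℓ + 1 + d) k)))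

/-- Copies in which the curve `cut ℓ k` is closed up are not cut again: the monodromy
around them is trivial in the whole tower. -/
theorem IsCutSequence.gluing_pow_eq_self (hcut : IsCutSequence cut) (ℓ d : ℕ) (k : Handle)
    {i : Fin 3} (hi : crossing k i = i) (w : Copies (ℓ + 1 + d))
    (hw : prefixOf (ℓ + 1) d w = ((cut ℓ k, i) : Copies ℓ × Fin 3)) :
    (gluing cut (ℓ + 1 + d) k ^ Function.minimalPeriod (gluing cut ℓ k) (cut ℓ k)) w = w := by
  induction d with
  | zero =>
    have hw' : w = ((cut ℓ k, i) : Copies ℓ × Fin 3) := hw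
    rw [hw']
    exact (reglue_pow_minimalPeriod _ _ _ i).trans (congrArg (Prod.mk (cut ℓ k)) hi)
  | succ d ih =>
    obtain ⟨v, j⟩ := w
    have hv := ih v hw
    -- The last digit `j` is unchanged if the orbit of `v` avoids the cut. An orbit meeting it
    -- would, after truncation to level `ℓ + 1`, put `(cut ℓ k, 1)` in the cycle of a copy numbered
    -- `i`, forcing `i = 1`; but both crossings move 1.
    refine (reglue_pow_of_forall_ne _ _ _ (fun n hn => ?_) j).trans (congrArg (·, j) hv)
    have hp : prefixOf (ℓ + 1) d (cut (ℓ + 1 + d) k) =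
        (gluing cut (ℓ + 1) k ^ n) (prefixOf (ℓ + 1) d v) :=
      (congrArg (prefixOf (ℓ + 1) d) hn.symm).trans (prefixOf_pow cut _ d k n v)
    have hc := (hcut.sameCycle_prefixOf_cut ℓ d k).trans
      (hp ▸ Equiv.Perm.sameCycle_pow_left.2 (.refl _ _))
    have h1 := (sameCycle_snd_iff _ _ _ hi hc).2 (congrArg Prod.snd hw)
    change (1 : Fin 3) = i at h1
    subst h1
    cases k <;> exact absurd hi (by decide)

end Monodromy

end Schori

/-! ### The cut handle is path connected -/

namespace CutHandle

/-- Moving the angle away from 0 only increases its norm, so the path avoids the removed disc. It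
ends at 1/2 or -1/2 according to the sign of `x`, which is the same point of the circle. -/
theorem exists_joinedIn_half (t : unitInterval) (x : ℝ) (hx : |x| ≤ 1 / 2)
    (h : 1 / 4 ≤ max |(t : ℝ) - 1 / 2| |x|) :
    JoinedIn {a : unitInterval × UnitAddCircle | 1 / 4 ≤ max |(a.1 : ℝ) - 1 / 2| ‖a.2‖}
      (t, (x : UnitAddCircle)) (t, ((1 / 2 : ℝ) : UnitAddCircle)) := by
  have hnorm : ∀ r : ℝ, |r| ≤ 1 / 2 → ‖(r : UnitAddCircle)‖ = |r| := fun r hr =>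
    (AddCircle.norm_coe_eq_abs_iff 1 one_ne_zero).2 (by simpa using hr)
  have hneg : ((-(1 / 2) : ℝ) : UnitAddCircle) = ((1 / 2 : ℝ) : UnitAddCircle) := by
    have := AddCircle.coe_add_period 1 (-(1 / 2) : ℝ)
    rw [← this]; norm_num
  have hseg : ∀ s : Set ℝ, IsPathConnected s → (∀ r ∈ s, |x| ≤ |r| ∧ |r| ≤ 1 / 2) →
      ∀ r ∈ s, ∀ r' ∈ s, JoinedIn
        {a : unitInterval × UnitAddCircle | 1 / 4 ≤ max |(a.1 : ℝ) - 1 / 2| ‖a.2‖}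
        (t, (r : UnitAddCircle)) (t, (r' : UnitAddCircle)) := by
    intro s hs hsx r hr r' hr'
    have hf : Continuous fun r : ℝ => (t, (r : UnitAddCircle)) :=
      continuous_const.prodMk (AddCircle.continuous_mk' 1)
    refine ((hs.image hf).joinedIn _ (mem_image_of_mem _ hr) _ (mem_image_of_mem _ hr')).mono ?_
    rintro _ ⟨u, hu, rfl⟩
    change 1 / 4 ≤ max |(t : ℝ) - 1 / 2| ‖(u : UnitAddCircle)‖
    rw [hnorm u (hsx u hu).2]
    exact h.trans (max_le_max_left _ (hsx u hu).1)
  rcases le_total 0 x with h0 | h0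
  · rw [abs_of_nonneg h0] at hx
    refine hseg (Icc x (1 / 2)) ((convex_Icc _ _).isPathConnected ⟨x, le_rfl, hx⟩)
      (fun r hr => ?_) x ⟨le_rfl, hx⟩ _ ⟨hx, le_rfl⟩
    rw [abs_of_nonneg h0, abs_of_nonneg (h0.trans hr.1)]
    exact hr
  · rw [abs_of_nonpos h0] at hx
    rw [← hneg]
    refine hseg (Icc (-(1 / 2)) x) ((convex_Icc _ _).isPathConnected ⟨x, by linarith, le_rfl⟩)
      (fun r hr => ?_) x ⟨by linarith, le_rfl⟩ _ ⟨le_rfl, by linarith⟩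
    rw [abs_of_nonpos h0, abs_of_nonpos (hr.2.trans h0)]
    constructor <;> linarith [hr.1, hr.2]

theorem joined (a b : CutHandle) : Joined a b := by
  have hhalf : ∀ a : CutHandle, JoinedIn
      {a : unitInterval × UnitAddCircle | 1 / 4 ≤ max |(a.1 : ℝ) - 1 / 2| ‖a.2‖}
      a.1 (a.1.1, ((1 / 2 : ℝ) : UnitAddCircle)) := by
    rintro ⟨⟨t, θ⟩, ha⟩
    obtain ⟨x, rfl⟩ := QuotientAddGroup.mk_surjective θ
    -- This representative of the angle has absolute value at most 1/2, where the circle norm is the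
    -- absolute value.
    have e : ((x - round x : ℝ) : UnitAddCircle) = x := by simp
    have ha' : 1 / 4 ≤ max |(t : ℝ) - 1 / 2| |x - round x| := by
      rw [← UnitAddCircle.norm_eq]; exact ha
    have := exists_joinedIn_half t (x - round x) (abs_sub_round x) ha'
    rwa [e] at this
  have hmid : JoinedIn
      {a : unitInterval × UnitAddCircle | 1 / 4 ≤ max |(a.1 : ℝ) - 1 / 2| ‖a.2‖}
      (a.1.1, ((1 / 2 : ℝ) : UnitAddCircle)) (b.1.1, ((1 / 2 : ℝ) : UnitAddCircle)) := by
    have hf : Continuous fun t : unitInterval => (t, ((1 / 2 : ℝ) : UnitAddCircle)) := by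
      fun_prop
    have hI : IsPathConnected (Icc (0 : ℝ) 1) :=
      (convex_Icc (0 : ℝ) 1).isPathConnected ⟨0, left_mem_Icc.2 zero_le_one⟩
    have : PathConnectedSpace unitInterval := isPathConnected_iff_pathConnectedSpace.1 hI
    refine (((isPathConnected_univ (X := unitInterval)).image hf).joinedIn
      _ (mem_image_of_mem _ (mem_univ a.1.1)) _ (mem_image_of_mem _ (mem_univ b.1.1))).mono ?_
    rintro _ ⟨t, -, rfl⟩
    change 1 / 4 ≤ max |(t : ℝ) - 1 / 2| ‖((1 / 2 : ℝ) : UnitAddCircle)‖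
    refine le_max_of_le_right ?_
    rw [(AddCircle.norm_coe_eq_abs_iff 1 one_ne_zero).2] <;> norm_num [abs_of_pos]
  exact ((hhalf a).trans (hmid.trans (hhalf b).symm)).joined_subtype

theorem exists_onRim : ∃ a : CutHandle, a.OnRim := by
  have h : max |(1 / 2 : ℝ) - 1 / 2| ‖((1 / 4 : ℝ) : UnitAddCircle)‖ = 1 / 4 := by
    rw [(AddCircle.norm_coe_eq_abs_iff 1 one_ne_zero).2] <;> norm_num [abs_of_pos]
  exact ⟨⟨(⟨1 / 2, by norm_num, by norm_num⟩, ((1 / 4 : ℝ) : UnitAddCircle)), h.ge⟩, h⟩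

end CutHandle

/-! ### Points of a glued surface with a given label -/

namespace Surface

variable {W V : Type} {σ : Handle → Equiv.Perm W} {τ : Handle → Equiv.Perm V}

theorem Region.mk_injective (R : Region) {k : Handle} {a : CutHandle} (ha : a ∈ R.lo k)
    {v w : W} (h : (Quot.mk _ ⟨(k, v), a⟩ : Surface σ) = Quot.mk _ ⟨(k, w), a⟩) : v = w := by
  have hv : (Quot.mk _ ⟨(k, v), a⟩ : Surface σ) ∈ R.sheet σ v := .inl ⟨ha, rfl⟩
  rw [h] at hv
  rcases hv with ⟨-, e⟩ | ⟨h', -⟩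
  · exact e.symm
  · exact absurd h' (R.disj k a ha)

/-- A point of a sheet is recovered from its image by the section of that sheet, and over `a` in
`lo` the section with label `w` has the value in copy `w`. So the fibre is indexed by labels. -/
theorem Region.exists_eq_mk (R : Region) (f : W → V) (hf : ∀ k w, f (σ k w) = τ k (f w))
    {k : Handle} {a : CutHandle} (ha : a ∈ R.lo k) {v : V} {z : Surface σ}
    (hz : map f hf z = (Quot.mk _ ⟨(k, v), a⟩ : Surface τ)) :
    ∃ w, f w = v ∧ z = Quot.mk _ ⟨(k, w), a⟩ := by
  have : Nonempty (Surface σ) := ⟨z⟩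
  have hv : map f hf z ∈ R.sheet τ v := hz ▸ .inl ⟨ha, rfl⟩
  have key : ∀ w, R.sec (σ := σ) τ w (map f hf z) = Quot.mk _ ⟨(k, w), a⟩ := fun w => by
    rw [hz]; exact if_pos ha
  obtain ⟨⟨⟨l, u⟩, b⟩⟩ := z
  rcases hv with ⟨h1, h2⟩ | ⟨h1, h2⟩
  · exact ⟨u, h2, (if_pos h1).symm.trans (key u)⟩
  · refine ⟨σ l u, (hf l u).trans h2, Eq.trans ?_ (key (σ l u))⟩
    refine Eq.symm ((if_neg fun h' => R.disj l b h' h1).trans ((if_pos h1).trans ?_))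
    simp only [Equiv.symm_apply_apply]; rfl

/-- On `lo` the label is the copy itself, which makes fibres easy to index. Only points on the side
t = 1 need another representative, obtained across the seam. -/
theorem exists_eq_mk_of_lo (z : Surface σ) :
    ∃ (R : Region) (k : Handle) (w : W) (a : CutHandle), a ∈ R.lo k ∧
      z = Quot.mk _ ⟨(k, w), a⟩ := by
  obtain ⟨⟨⟨k, w⟩, a⟩⟩ := z
  rcases lt_or_ge (a.1.1 : ℝ) (1 / 4) with h | h
  · exact ⟨collarRegion k, k, w, a, ⟨rfl, h⟩, rfl⟩
  rcases lt_or_ge (a.1.1 : ℝ) 1 with h' | h'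
  · exact ⟨interiorRegion, k, w, a, ⟨by linarith, h'⟩, rfl⟩
  · obtain ⟨⟨t, θ⟩, ha⟩ := a
    obtain rfl : t = 1 := le_antisymm unitInterval.le_one' h'
    exact ⟨collarRegion k, k, σ k w, CutHandle.incoming θ,
      ⟨rfl, by norm_num [CutHandle.incoming]⟩, Quot.sound (.seam k w θ)⟩

end Surface

/-! ### Cylinders as a clopen basis, and stabilisers of a coordinate. -/

namespace Presentation

variable {P : Presentation} {x₀ : P.M 0}

theorem isClopen_cylinder (y : P.Fiber x₀) (n : ℕ) : IsClopen (cylinder y n) := by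
  refine ⟨⟨isOpen_iff_forall_mem_open.2 fun z hz => ⟨cylinder z n, fun w hw hwy => hz ?_,
    isOpen_cylinder z n, rfl⟩⟩, isOpen_cylinder y n⟩
  exact (show w.1.1 n = z.1.1 n from hw).symm.trans hwy

/-- A basic open set constrains finitely many coordinates, and the one of largest index determines
the others. -/
theorem exists_cylinder_subset {V : Set (P.Fiber x₀)} (hV : IsOpen V) {y : P.Fiber x₀}
    (hy : y ∈ V) : ∃ n, cylinder y n ⊆ V := by
  obtain ⟨V', hV', rfl⟩ := isOpen_induced_iff.1 hV
  obtain ⟨V'', hV'', rfl⟩ := isOpen_induced_iff.1 hV'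
  obtain ⟨I, u, hu, hI⟩ := isOpen_pi_iff.1 hV'' y.1.1 hy
  refine ⟨I.sup id, fun z hz => hI fun i hi => ?_⟩
  have : z.1.1 i = y.1.1 i := coord_eq_of_le hz (Finset.le_sup (f := id) hi)
  rw [this]
  exact (hu i hi).2

/-- The lift of a representing loop to `M n` closes up, and its class maps to `g`. -/
theorem mem_chainGroup {y : P.Fiber x₀} {n : ℕ} {g : FundamentalGroup (P.M 0) x₀}
    (hg : (holonomyMap g y).1.1 n = y.1.1 n) : g ∈ chainGroup y n := by
  induction g using Quotient.inductionOn with | _ γ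
  have h := γ.source.trans y.2.symm
  let δ : Path (y.1.1 n) (y.1.1 n) := ⟨(lift y.1 γ h n).1, (lift y.1 γ h n).2, hg⟩
  refine ⟨Quotient.mk _ δ, ?_⟩
  refine (FundamentalGroup.mapOfEq_apply _ _ _).trans ?_
  refine congrArg (Quotient.mk _) (Path.ext (funext fun t => ?_))
  exact congrArg (fun f : C(unitInterval, P.M 0) => f t) (q_lift y.1 γ h n)

end Presentation

/-! ### Realising words by loops and their lifts through the tower. -/

namespace Schori

open Presentation

section Points

variable (cut : ∀ ℓ, Handle → Copies ℓ)

/-- The point of the copy `w` of the cut handle `k` in `X ℓ`. -/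
def point (ℓ : ℕ) (k : Handle) (w : Copies ℓ) (a : CutHandle) : (presentation cut).M ℓ :=
  (Quot.mk _ ⟨(k, w), a⟩ : Surface (gluing cut ℓ))

theorem q_point : ∀ (ℓ : ℕ) (k : Handle) (w : Copies ℓ) (a : CutHandle),
    (presentation cut).q ℓ (point cut ℓ k w a) = point cut 0 k () a
  | 0, _, _, _ => rfl
  | ℓ + 1, k, w, a => q_point ℓ k (w : Copies ℓ × Fin 3).1 a

theorem continuous_point (ℓ : ℕ) (k : Handle) (w : Copies ℓ) : Continuous (point cut ℓ k w) :=
  continuous_quot_mk.comp (continuous_sigmaMk (σ := fun _ : Handle × Copies ℓ => CutHandle)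
    (i := (k, w)))

/-- There is a path in `X 0` between two points whose lifts to all `X ℓ` permute the copies
by the word `u`. -/
def Carries (u : FreeGroup Handle) (x y : Handle × CutHandle) : Prop :=
  ∃ γ : Path (point cut 0 x.1 () x.2) (point cut 0 y.1 () y.2), ∀ ℓ w,
    ∃ Γ : Path (point cut ℓ x.1 w x.2) (point cut ℓ y.1 (monodromy cut ℓ u w) y.2),
      ∀ t, (presentation cut).q ℓ (Γ t) = γ t

variable {cut}

/-- The order is reversed since paths concatenate from left to right and permutations compose from
right to left. -/
theorem Carries.trans {u v : FreeGroup Handle} {x y z : Handle × CutHandle}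
    (h : Carries cut u x y) (h' : Carries cut v y z) : Carries cut (v * u) x z := by
  obtain ⟨γ, hγ⟩ := h
  obtain ⟨γ', hγ'⟩ := h'
  refine ⟨γ.trans γ', fun ℓ w => ?_⟩
  obtain ⟨Γ, hΓ⟩ := hγ ℓ w
  obtain ⟨Γ', hΓ'⟩ := hγ' ℓ (monodromy cut ℓ u w)
  refine ⟨(Γ.trans Γ').cast rfl (by rw [map_mul]; rfl), fun t => ?_⟩
  change (presentation cut).q ℓ ((Γ.trans Γ') t) = _
  rw [Path.trans_apply, Path.trans_apply]
  split_ifs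
  · exact hΓ _
  · exact hΓ' _

theorem Carries.symm {u : FreeGroup Handle} {x y : Handle × CutHandle}
    (h : Carries cut u x y) : Carries cut u⁻¹ y x := by
  obtain ⟨γ, hγ⟩ := h
  refine ⟨γ.symm, fun ℓ w => ?_⟩
  obtain ⟨Γ, hΓ⟩ := hγ ℓ (monodromy cut ℓ u⁻¹ w)
  have e : monodromy cut ℓ u (monodromy cut ℓ u⁻¹ w) = w := by
    rw [map_inv]; exact Equiv.apply_symm_apply _ _
  exact ⟨Γ.symm.cast (by rw [e]) rfl, fun t => hΓ _⟩

theorem carries_one_of_path (k : Handle) {a b : CutHandle} (δ : Path a b) :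
    Carries cut 1 (k, a) (k, b) :=
  ⟨δ.map (continuous_point cut 0 k ()), fun ℓ w =>
    ⟨(δ.map (continuous_point cut ℓ k w)).cast rfl (by rw [map_one]; rfl),
      fun t => q_point cut ℓ k w (δ t)⟩⟩

theorem carries_rim {a : CutHandle} (ha : a.OnRim) : Carries cut 1 (.H, a) (.F, a) := by
  have e : ∀ ℓ (w : Copies ℓ), point cut ℓ .H w a = point cut ℓ .F w a :=
    fun ℓ w => Quot.sound (.rim w a ha)
  exact ⟨(Path.refl _).cast rfl (e 0 ()).symm, fun ℓ w =>
    ⟨(Path.refl _).cast rfl (by rw [map_one]; exact (e ℓ w).symm),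
      fun t => q_point cut ℓ .H w a⟩⟩

/-- Constant paths suffice: the two sides of a seam are the same point, whose copy is renamed by the
gluing. -/
theorem carries_seam (k : Handle) (θ : UnitAddCircle) :
    Carries cut (FreeGroup.of k) (k, CutHandle.outgoing θ) (k, CutHandle.incoming θ) := by
  have e : ∀ ℓ (w : Copies ℓ), point cut ℓ k (gluing cut ℓ k w) (CutHandle.incoming θ) =
      point cut ℓ k w (CutHandle.outgoing θ) :=
    fun ℓ w => (Quot.sound (.seam k w θ)).symm
  exact ⟨(Path.refl _).cast rfl (e 0 ()), fun ℓ w =>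
    ⟨(Path.refl _).cast rfl (by rw [monodromy_of]; exact e ℓ w),
      fun t => q_point cut ℓ k w _⟩⟩

/-- Paths inside the connected cut handles, changing handle at a rim point, cross no seam and so
keep the copy. -/
theorem carries_one (x y : Handle × CutHandle) : Carries cut 1 x y := by
  obtain ⟨r, hr⟩ := CutHandle.exists_onRim
  have key : ∀ x : Handle × CutHandle, Carries cut 1 x (.F, r) := by
    rintro ⟨k, a⟩
    have h := carries_one_of_path (cut := cut) k (CutHandle.joined a r).somePath
    cases k
    · simpa using h.trans (carries_rim hr)
    · exact h
  simpa using (key x).trans (key y).symm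

theorem carries (u : FreeGroup Handle) (x : Handle × CutHandle) : Carries cut u x x := by
  -- Go to a seam, cross it once, and come back without crossing any.
  have hof : ∀ k, Carries cut (FreeGroup.of k) x x := fun k => by
    simpa using (carries_one x _).trans ((carries_seam k 0).trans (carries_one _ x))
  induction u using FreeGroup.induction_on with
  | C1 => exact carries_one x x
  | of k => exact hof k
  | inv_of k _ => exact (hof k).symm
  | mul u v hu hv => exact hv.trans hu

/-- One `g` serves all levels and all points, because the path that carries `u` is chosen in X_0
before its lifts; unique lifting identifies these with the lifts defining the holonomy. -/
theorem exists_holonomyMap (u : FreeGroup Handle) (k : Handle) (a : CutHandle) :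
    ∃ g : FundamentalGroup ((presentation cut).M 0) (point cut 0 k () a),
      ∀ (z : (presentation cut).Fiber (point cut 0 k () a)) ℓ w, z.1.1 ℓ = point cut ℓ k w a →
        (holonomyMap g z).1.1 ℓ = point cut ℓ k (monodromy cut ℓ u w) a := by
  obtain ⟨γ, hγ⟩ := carries (cut := cut) u (k, a)
  refine ⟨Quotient.mk _ γ, fun z ℓ w hz => ?_⟩
  obtain ⟨Γ, hΓ⟩ := hγ ℓ w
  have := lift_unique z.1 (γ : C(unitInterval, (presentation cut).M 0))
    (γ.source.trans z.2.symm) ℓ (Γ : C(unitInterval, (presentation cut).M ℓ))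
    (ContinuousMap.ext hΓ) (Γ.source.trans hz.symm)
  exact (congrArg (fun f : C(unitInterval, (presentation cut).M ℓ) => f 1) this).trans Γ.target

theorem exists_coord_eq_point {R : Surface.Region} {k : Handle} {a : CutHandle}
    (ha : a ∈ R.lo k) (z : (presentation cut).Fiber (point cut 0 k () a)) :
    ∀ ℓ, ∃ w, z.1.1 ℓ = point cut ℓ k w a
  | 0 => ⟨(), z.2⟩
  | ℓ + 1 => by
    obtain ⟨v, hv⟩ := exists_coord_eq_point ha z ℓ
    obtain ⟨w, -, hw⟩ := R.exists_eq_mk (σ := gluing cut (ℓ + 1)) (τ := gluing cut ℓ)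
      (Prod.fst : Copies ℓ × Fin 3 → Copies ℓ) (fun _ _ => rfl) ha
      ((z.1.2 ℓ).trans hv)
    exact ⟨w, hw⟩

theorem point_injective {R : Surface.Region} {k : Handle} {a : CutHandle}
    (ha : a ∈ R.lo k) {ℓ : ℕ} {v w : Copies ℓ} (h : point cut ℓ k v a = point cut ℓ k w a) :
    v = w :=
  R.mk_injective ha h

theorem coord_eq_point_prefixOf {k : Handle} {a : CutHandle}
    {z : (presentation cut).Fiber (point cut 0 k () a)} {ℓ : ℕ} : ∀ (d : ℕ)
    {w : Copies (ℓ + d)}, z.1.1 (ℓ + d) = point cut (ℓ + d) k w a →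
    z.1.1 ℓ = point cut ℓ k (prefixOf ℓ d w) a
  | 0, _, h => h
  | d + 1, _, h => coord_eq_point_prefixOf d ((z.1.2 (ℓ + d)).symm.trans (congrArg (proj cut _) h))

end Points

end Schori

/-! ### An element fixing one cylinder pointwise and swapping two others. -/

namespace Schori

open Presentation

variable {cut : ∀ ℓ, Handle → Copies ℓ}

/-- Every cylinder of the fibre contains three disjoint cylinders such that some element of its
chain group fixes the points of one of them and interchanges the two others. -/
theorem IsCutSequence.exists_holonomy_swap (hcut : IsCutSequence cut)
    {x₀ : (presentation cut).M 0} (y : (presentation cut).Fiber x₀) (n : ℕ) :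
    ∃ g ∈ chainGroup y n, ∃ D : Fin 3 → Set ((presentation cut).Fiber x₀),
      (∀ i, IsClopen (D i) ∧ (D i).Nonempty ∧ D i ⊆ cylinder y n) ∧
      (∀ i j, i ≠ j → Disjoint (D i) (D j)) ∧ (∀ z ∈ D 2, holonomy x₀ g z = z) ∧
      holonomy x₀ g '' D 0 = D 1 ∧ holonomy x₀ g '' D 1 = D 0 := by
  obtain ⟨R, k, b, a, ha, hx⟩ := Surface.exists_eq_mk_of_lo (σ := gluing cut 0) x₀
  change x₀ = point cut 0 k () a at hx
  subst hx
  obtain ⟨v, hv⟩ := exists_coord_eq_point ha y n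
  obtain ⟨v', hv'⟩ := exists_coord_eq_point ha y (n + 1)
  obtain ⟨u, hu⟩ := exists_monodromy_eq cut n v (cut n .H)
  let N := Function.minimalPeriod (gluing cut n .H) (cut n .H)
  let c : Fin 3 → Copies (n + 1) := fun i => ((cut n .H, i) : Copies n × Fin 3)
  -- The labels of the three points of X_{n+1} over `y` at level `n`, numbered so that `u` takes
  -- them to the three copies of the cut.
  let w : Fin 3 → Copies (n + 1) := fun i => monodromy cut (n + 1) u⁻¹ (c i)
  have hinv : ∀ ℓ x, monodromy cut ℓ u⁻¹ (monodromy cut ℓ u x) = x := fun ℓ x => by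
    rw [map_inv]; exact Equiv.symm_apply_apply _ _
  have hinv' : ∀ ℓ x, monodromy cut ℓ u (monodromy cut ℓ u⁻¹ x) = x := fun ℓ x => by
    rw [map_inv]; exact Equiv.apply_symm_apply _ _
  have hw : ∀ i, monodromy cut (n + 1) u (w i) = c i := fun i => hinv' _ _
  have hwinj : Function.Injective w :=
    (Equiv.injective _).comp (Prod.mk_right_injective (cut n .H))
  have hwv : ∀ i, (w i : Copies n × Fin 3).1 = v := fun i => by
    refine (monodromy_fst cut n u⁻¹ (c i)).trans ?_
    change monodromy cut n u⁻¹ (cut n .H) = v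
    rw [← hu, hinv]
  -- Move to the cut, go once around its full cycle in X_n, move back.
  let s : FreeGroup Handle := u⁻¹ * FreeGroup.of .H ^ N * u
  have hs : ∀ ℓ x, monodromy cut ℓ s x =
      monodromy cut ℓ u⁻¹ ((gluing cut ℓ .H ^ N) (monodromy cut ℓ u x)) := fun ℓ x => by
    rw [map_mul, map_mul, map_pow, monodromy_of]; rfl
  have hsw : ∀ i, monodromy cut (n + 1) s (w i) = w (crossing .H i) := fun i => by
    rw [hs, hw]
    exact congrArg (monodromy cut (n + 1) u⁻¹) (reglue_pow_minimalPeriod _ _ _ i)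
  obtain ⟨g, hg⟩ := exists_holonomyMap (cut := cut) s k a
  let D : Fin 3 → Set ((presentation cut).Fiber (point cut 0 k () a)) :=
    fun i => {z | z.1.1 (n + 1) = point cut (n + 1) k (w i) a}
  have hDne : ∀ i, (D i).Nonempty := fun i => by
    obtain ⟨t, ht⟩ := exists_monodromy_eq cut (n + 1) v' (w i)
    obtain ⟨f, hf⟩ := exists_holonomyMap (cut := cut) t k a
    exact ⟨holonomyMap f y, (hf y _ _ hv').trans (by rw [ht])⟩
  have hDcyl : ∀ i, ∀ z ∈ D i, z.1.1 n = point cut n k v a := fun i z hz => by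
    rw [← hwv i]
    exact coord_eq_point_prefixOf 1 hz
  have himage : ∀ i, holonomy _ g '' D i = D (crossing .H i) := fun i => by
    refine Subset.antisymm ?_ fun z hz => ?_
    · rintro _ ⟨z, hz, rfl⟩
      exact (hg z _ _ hz).trans (by rw [hsw])
    · obtain ⟨z, rfl⟩ := (holonomy _ g).surjective z
      obtain ⟨x, hx⟩ := exists_coord_eq_point ha z (n + 1)
      have e := point_injective ha ((hg z _ _ hx).symm.trans hz)
      rw [← hsw, EmbeddingLike.apply_eq_iff_eq] at e
      exact ⟨z, hx.trans (by rw [e]), rfl⟩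
  -- The coordinates from level `n + 1` on determine the point, and there the conjugated power of
  -- the gluing is trivial because `crossing .H` fixes 2.
  have hfix : ∀ z ∈ D 2, holonomy _ g z = z := fun z hz => by
    have hd : ∀ d, (holonomyMap g z).1.1 (n + 1 + d) = z.1.1 (n + 1 + d) := fun d => by
      obtain ⟨x, hx⟩ := exists_coord_eq_point ha z (n + 1 + d)
      have hp : prefixOf (n + 1) d x = w 2 :=
        point_injective ha ((coord_eq_point_prefixOf d hx).symm.trans hz)
      have h := hcut.gluing_pow_eq_self n d .H (i := 2) (by decide)
        (monodromy cut (n + 1 + d) u x) (by rw [prefixOf_monodromy, hp]; exact hw 2)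
      rw [hg z _ _ hx, hx, hs, h, hinv]
    exact Subtype.ext (Subtype.ext (funext fun ℓ =>
      coord_eq_of_le (hd ℓ) (Nat.le_add_left ℓ (n + 1))))
  refine ⟨g, mem_chainGroup ?_, D, fun i => ⟨?_, hDne i, fun z hz => (hDcyl i z hz).trans hv.symm⟩,
    fun i j hij => disjoint_left.2 fun z hz hz' => hij ?_, hfix, himage 0, himage 1⟩
  -- The effect of `g` on coordinate `n` depends only on that coordinate, and a fixed point in `D 2`
  -- shares it with `y`.
  · obtain ⟨z, hz⟩ := hDne 2
    rw [hg y n v hv, hv, ← hg z n v (hDcyl 2 z hz), ← hDcyl 2 z hz]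
    exact congrArg (fun z => z.1.1 n) (hfix z hz)
  · obtain ⟨z, hz⟩ := hDne i
    convert isClopen_cylinder z (n + 1) using 1
    ext z'
    exact ⟨fun h => h.trans hz.symm, fun h => (show z'.1.1 (n + 1) = _ from h).trans hz⟩
  · exact hwinj (point_injective ha (hz.symm.trans hz'))

end Schori

/-! ### Failure of strong quasi-analyticity. -/

theorem mainTheorem7 (cut : ∀ ℓ, Handle → Schori.Copies ℓ) (hcut : Schori.IsCutSequence cut)
    (x₀ : (Schori.presentation cut).M 0) :
    (∀ (y : (Schori.presentation cut).Fiber x₀) (n : ℕ),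
      ¬ IsSQA (pseudoStarGroup (Presentation.sectionHolonomy y n)) ∧
      ∃ (g : Presentation.chainGroup y n) (A B C : Set (Presentation.cylinder y n)),
        (IsClopen A ∧ A.Nonempty) ∧ (IsClopen B ∧ B.Nonempty) ∧ (IsClopen C ∧ C.Nonempty) ∧
        Disjoint A B ∧ Disjoint A C ∧ Disjoint B C ∧
        (∀ z ∈ A, Presentation.sectionHolonomy y n g z = z) ∧
        Presentation.sectionHolonomy y n g '' B = C ∧
        Presentation.sectionHolonomy y n g '' C = B) ∧
    ∀ V : Set ((Schori.presentation cut).Fiber x₀), IsClopen V → V.Nonempty →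
      ¬ IsSQA (inducedOn (pseudoStarGroup (Presentation.holonomy x₀)) V) := by
  refine ⟨fun y n => ?_, fun V hV ⟨y, hy⟩ hsqa => ?_⟩
  · obtain ⟨g, hg, D, hD, hdisj, hfix, h01, h10⟩ := hcut.exists_holonomy_swap y n
    let E : Fin 3 → Set (Presentation.cylinder y n) := fun i => Subtype.val ⁻¹' D i
    have hEclopen : ∀ i, IsClopen (E i) := fun i => (hD i).1.preimage continuous_subtype_val
    have hEne : ∀ i, (E i).Nonempty := fun i => by
      obtain ⟨z, hz⟩ := (hD i).2.1
      exact ⟨⟨z, (hD i).2.2 hz⟩, hz⟩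
    have hEdisj : ∀ i j, i ≠ j → Disjoint (E i) (E j) :=
      fun i j hij => (hdisj i j hij).preimage _
    let φ := Presentation.sectionHolonomy y n ⟨g, hg⟩
    have hEfix : ∀ z ∈ E 2, φ z = z := fun z hz => Subtype.ext (hfix z.1 hz)
    have himage : ∀ i j, Presentation.holonomy x₀ g '' D i = D j → φ '' E i = E j := by
      intro i j h
      refine Subset.antisymm ?_ fun z hz => ?_
      · rintro _ ⟨z, hz, rfl⟩
        exact h.subset (mem_image_of_mem _ hz)
      · obtain ⟨z, rfl⟩ := φ.surjective z
        obtain ⟨z', hz', e⟩ := h.superset hz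
        exact ⟨z, show z.1 ∈ D i from (Presentation.holonomy x₀ g).injective e ▸ hz', rfl⟩
    refine ⟨fun hsqa => ?_, ⟨g, hg⟩, E 2, E 0, E 1, ⟨hEclopen 2, hEne 2⟩, ⟨hEclopen 0, hEne 0⟩,
      ⟨hEclopen 1, hEne 1⟩, hEdisj _ _ (by decide), hEdisj _ _ (by decide),
      hEdisj _ _ (by decide), hEfix, himage 0 1 h01, himage 1 0 h10⟩
    obtain ⟨z, hz⟩ := hEne 0
    have hid := hsqa φ.toOpenPartialHomeomorph ⟨⟨g, hg⟩, fun _ _ => rfl⟩ (E 2) (hEclopen 2).2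
      (hEne 2) (subset_univ _) hEfix (mem_univ z)
    have hz1 : φ z ∈ E 1 := (himage 0 1 h01).subset (mem_image_of_mem _ hz)
    exact disjoint_left.1 (hEdisj 0 1 (by decide)) hz ((show φ z = z from hid) ▸ hz1)
  · obtain ⟨n, hn⟩ := Presentation.exists_cylinder_subset hV.2 hy
    obtain ⟨g, hg, D, hD, hdisj, hfix, h01, -⟩ := hcut.exists_holonomy_swap y n
    let φ := Presentation.holonomy x₀ g
    -- Restricting to a cylinder inside `V` gives a member of the induced family, since `g` lies in
    -- the chain group and so preserves that cylinder.
    let h := φ.toOpenPartialHomeomorph.restrOpen (Presentation.cylinder y n)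
      (Presentation.isOpen_cylinder y n)
    have hsource : h.source = Presentation.cylinder y n := univ_inter _
    obtain ⟨z, hz⟩ := (hD 0).2.1
    have hid := hsqa h ⟨⟨g, fun _ _ => rfl⟩, hsource.trans_subset hn, ?_⟩ (D 2) (hD 2).1.2
      (hD 2).2.1 ((hD 2).2.2.trans hsource.superset) hfix
      (hsource.superset ((hD 0).2.2 hz))
    · have hz1 : φ z ∈ D 1 := h01.subset (mem_image_of_mem _ hz)
      exact disjoint_left.1 (hdisj 0 1 (by decide)) hz ((show φ z = z from hid) ▸ hz1)
    · rw [← h.image_source_eq_target, hsource]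
      rintro _ ⟨z, hz, rfl⟩
      exact hn (Presentation.holonomyMap_mem_cylinder y n hg hz)
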